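/- Let $\mathcal{C}$ be a braided monoidal category with unit object $I$ and braiding $\psi$; the braiding is not assumed to be symmetric. (In the intended applications $\mathcal{C}$ is moreover abelian, but no additive structure is needed.) Associativity and unit constraints are suppressed, $H^n$ denotes $H^{\otimes n}$ with $H^0=I$, and $(f,g,\dots)$ denotes $f\otimes g\otimes\cdots$. Let $(H,m,\eta,\Delta,\varepsilon,S)$ be a Hopf algebra in $\mathcal{C}$. Let $\delta:H\to I$ be a character (an algebra map: $\delta m=\delta\otimes\delta$, $\delta\eta=\mathrm{id}_I$) and $\sigma:I\to H$ a co-character (a coalgebra map: $\Delta\sigma=\sigma\otimes\sigma$, $\varepsilon\sigma=\mathrm{id}_I$), and put $\widetilde S=(\delta\otimes S)\Delta$. Suppose that $(\delta,\sigma)$ is a braided modular pair in involution, i.e. $\delta\sigma=\mathrm{id}_I$ and $m(m\otimes \mathrm{id})(S\sigma\otimes\widetilde S^2\otimes\sigma)=\mathrm{id}_H$. Then the objects $C^0=I$ and $C^n=H^{n}$ $(n\ge 1)$, with the faces $\delta_i:C^{n-1}\to C^n$ $(n\geq 1,\ 0\le i\le n)$, degeneracies $\sigma_i:C^{n+1}\to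 C^n$ $(n\ge 0,\ 0\le i\le n)$ and cyclic operators $\tau_n:C^n\to C^n$ given by \[ \delta_i=\begin{cases}(\eta,1,\dots,1), & i=0,\\ (1,\dots,1,\Delta,1,\dots,1)\ \text{with } \Delta \text{ on the } i\text{-th factor}, & 1\le i\le n-1,\\ (1,\dots,1,\sigma), & i=n,\end{cases} \] \[ \sigma_i=(1,\dots,1,\varepsilon,1,\dots,1)\ \text{with } \varepsilon \text{ on the } (i+1)\text{-th factor}, \] \[ \tau_0=\mathrm{id}_I,\qquad \tau_n=m_n\,(\Delta^{n-1}\widetilde S,\,1_{H^{n-1}},\,\sigma)\quad (n\ge 1), \] form a para-cocyclic object in $\mathcal{C}$. Here $\Delta^{n-1}:H\to H^n$ is the iterated comultiplication, $m_1=m$, and for $n\ge 2$ \[ m_n=(\underbrace{m,\dots,m}_{n})\,\mathcal F_n(\psi),\qquad \mathcal F_n(\psi)=\prod_{j=1}^{n-1}(1_{H^j},\underbrace{\psi_{H,H},\dots,\psi_{H,H}}_{n-j},1_{H^j}), \] where in the product of morphisms the factor $j=1$ stands leftmost, so that the factor $j=n-1$ is applied first. A para-cocyclic object is a collection $(C^n,\delta_i,\sigma_i,\tau_n)_{n\ge0}$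 that satisfies all axioms of a cocyclic object except $\tau_n^{n+1}=\mathrm{id}$; that is, it satisfies the cosimplicial identities together with \[ \tau_n\delta_0=\delta_n,\quad \tau_n\delta_i=\delta_{i-1}\tau_{n-1}\ (1\le i\le n),\quad \tau_n\sigma_0=\sigma_n\tau_{n+1}^2,\quad \tau_n\sigma_i=\sigma_{i-1}\tau_{n+1}\ (1\le i\le n). \] -/

import Mathlib

open CategoryTheory MonoidalCategory
open scoped MonObj ComonObj HopfObj

universe v u

/-! ### Para-cocyclic objects -/

/-- A para-cocyclic object in a category: objects `X n` (`n ≥ 0`), cofaces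
`d n i : X n ⟶ X (n+1)` (`0 ≤ i ≤ n+1`), codegeneracies `s n i : X (n+1) ⟶ X n` (`0 ≤ i ≤ n`) and
cyclic operators `t n : X n ⟶ X n`, subject to all the axioms of a cocyclic object except
`(t n) ^ (n+1) = 𝟙`. Compositions are written in diagrammatic order (`f ≫ g` is `g ∘ f`). -/
structure IsParaCocyclic {C : Type u} [Category.{v} C] (X : ℕ → C)
    (d : ∀ n : ℕ, Fin (n + 2) → (X n ⟶ X (n + 1)))
    (s : ∀ n : ℕ, Fin (n + 1) → (X (n + 1) ⟶ X n))
    (t : ∀ n : ℕ, X n ⟶ X n) : Prop where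
  /-- `d_{j+1} d_i = d_i d_j` for `i ≤ j`. -/
  d_comp_d : ∀ (n : ℕ) (i j : Fin (n + 2)), i ≤ j →
    d n i ≫ d (n + 1) j.succ = d n j ≫ d (n + 1) i.castSucc
  /-- `s_{j+1} d_i = d_i s_j` for `i ≤ j`. -/
  d_comp_s_of_le : ∀ (n : ℕ) (i : Fin (n + 2)) (j : Fin (n + 1)), i ≤ j.castSucc →
    d (n + 1) i.castSucc ≫ s (n + 1) j.succ = s n j ≫ d n i
  /-- `s_i d_i = 1`. -/
  d_comp_s_self : ∀ (n : ℕ) (i : Fin (n + 1)), d n i.castSucc ≫ s n i = 𝟙 (X n)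
  /-- `s_i d_{i+1} = 1`. -/
  d_comp_s_succ : ∀ (n : ℕ) (i : Fin (n + 1)), d n i.succ ≫ s n i = 𝟙 (X n)
  /-- `s_j d_{i+1} = d_i s_j` for `j < i`. -/
  d_comp_s_of_gt : ∀ (n : ℕ) (i : Fin (n + 2)) (j : Fin (n + 1)), j.castSucc < i →
    d (n + 1) i.succ ≫ s (n + 1) j.castSucc = s n j ≫ d n i
  /-- `s_j s_i = s_i s_{j+1}` for `i ≤ j`. -/
  s_comp_s : ∀ (n : ℕ) (i j : Fin (n + 1)), i ≤ j →
    s (n + 1) i.castSucc ≫ s n j = s (n + 1) j.succ ≫ s n i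
  /-- `t_{n+1} d_0 = d_{n+1}`. -/
  d_zero_comp_t : ∀ n : ℕ, d n 0 ≫ t (n + 1) = d n (Fin.last (n + 1))
  /-- `t_{n+1} d_{i+1} = d_i t_n` for `0 ≤ i ≤ n`. -/
  d_succ_comp_t : ∀ (n : ℕ) (i : Fin (n + 1)),
    d n i.succ ≫ t (n + 1) = t n ≫ d n i.castSucc
  /-- `t_n s_0 = s_n t_{n+1}²`. -/
  s_zero_comp_t : ∀ n : ℕ, s n 0 ≫ t n = t (n + 1) ≫ t (n + 1) ≫ s n (Fin.last n)
  /-- `t_n s_{i+1} = s_i t_{n+1}` for `0 ≤ i < n`. -/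
  s_succ_comp_t : ∀ (n : ℕ) (i : Fin n),
    s n i.succ ≫ t n = t (n + 1) ≫ s n i.castSucc

namespace BraidedHopf

variable {C : Type u} [Category.{v} C] [MonoidalCategory C]

/-- The tensor power `H^{⊗n} = H ⊗ (H ⊗ (⋯ ⊗ (H ⊗ I)))`, with `H^{⊗0} = I`. -/
def tensorPow (H : C) : ℕ → C
  | 0 => 𝟙_ C
  | n + 1 => H ⊗ tensorPow H n

/-- The canonical isomorphism `H^{⊗a} ⊗ H^{⊗b} ≅ H^{⊗(b+a)}` built from the constraints. -/
def concatIso (H : C) (b : ℕ) : (a : ℕ) → (tensorPow H a ⊗ tensorPow H b ≅ tensorPow H (b + a))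
  | 0 => λ_ (tensorPow H b)
  | a + 1 => α_ H (tensorPow H a) (tensorPow H b) ≪≫ whiskerLeftIso H (concatIso H b a)

section Braided

variable [BraidedCategory C]

/-- `(ψ, …, ψ, 1, …, 1)` on `H^{⊗N}`: the braiding on each of the first `k` consecutive pairs of
tensor factors. -/
def braidPairs (H : C) : (N k : ℕ) → (tensorPow H N ⟶ tensorPow H N)
  | N + 2, k + 1 => (α_ H H (tensorPow H N)).inv ≫ ((β_ H H).hom ⊗ₘ braidPairs H N k) ≫
      (α_ H H (tensorPow H N)).hom
  | N, _ => 𝟙 (tensorPow H N)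

/-- `(1_{H^j}, ψ, …, ψ, 1, …, 1)` on `H^{⊗N}`, with `k` copies of the braiding `ψ`. -/
def braidRow (H : C) : (N j k : ℕ) → (tensorPow H N ⟶ tensorPow H N)
  | N, 0, k => braidPairs H N k
  | N + 1, j + 1, k => H ◁ braidRow H N j k
  | 0, _ + 1, _ => 𝟙 (tensorPow H 0)

/-- The composite of the rows `(1_{H^j}, ψ, …, ψ, 1_{H^j})` on `H^{⊗2n}`, with `n - j` copies of
`ψ`, over `1 ≤ j ≤ r`: the row `j = r` is applied first and the row `j = 1` last. -/
def braidProd (H : C) (n : ℕ) : (r : ℕ) → (tensorPow H (2 * n) ⟶ tensorPow H (2 * n))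
  | 0 => 𝟙 (tensorPow H (2 * n))
  | r + 1 => braidRow H (2 * n) (r + 1) (n - (r + 1)) ≫ braidProd H n r

/-- `𝓕_n(ψ) = ∏_{j=1}^{n-1} (1_{H^j}, ψ, …, ψ, 1_{H^j})`, with `n - j` copies of `ψ` in the `j`-th
factor. -/
def shuffle (H : C) (n : ℕ) : tensorPow H (2 * n) ⟶ tensorPow H (2 * n) :=
  braidProd H n (n - 1)

end Braided

/-- `(m, …, m) : H^{⊗2n} ⟶ H^{⊗n}`. -/
def mulPairs (H : C) [MonObj H] : (n : ℕ) → (tensorPow H (2 * n) ⟶ tensorPow H n)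
  | 0 => 𝟙 (𝟙_ C)
  | n + 1 => (α_ H H (tensorPow H (2 * n))).inv ≫ (μ[H] ⊗ₘ mulPairs H n)

/-- `m_n = (m, …, m) 𝓕_n(ψ) : H^{⊗n} ⊗ H^{⊗n} ⟶ H^{⊗n}`. -/
def mulPow [BraidedCategory C] (H : C) [MonObj H] (n : ℕ) :
    tensorPow H n ⊗ tensorPow H n ⟶ tensorPow H n :=
  (concatIso H n n).hom ≫ eqToHom (congrArg (tensorPow H) (two_mul n).symm) ≫
    shuffle H n ≫ mulPairs H n

/-- The iterated comultiplication `Δ^n : H ⟶ H^{⊗(n+1)}`, where `Δ^0 = 1` and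
`Δ^{n+1} = (1 ⊗ Δ^n) Δ`. -/
def iterComul (H : C) [ComonObj H] : (n : ℕ) → (H ⟶ tensorPow H (n + 1))
  | 0 => (ρ_ H).inv
  | n + 1 => Δ[H] ≫ H ◁ iterComul H n

/-- `(1, …, 1, Δ, 1, …, 1)`, with `Δ` on the tensor factor of (zero-based) index `i`. -/
def comulAt (H : C) [ComonObj H] : (n : ℕ) → Fin n → (tensorPow H n ⟶ tensorPow H (n + 1))
  | 0, i => i.elim0
  | n + 1, i => Fin.cases (motive := fun _ => tensorPow H (n + 1) ⟶ tensorPow H (n + 2))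
      (Δ[H] ▷ tensorPow H n ≫ (α_ H H (tensorPow H n)).hom) (fun k => H ◁ comulAt H n k) i

/-- `(1, …, 1, ε, 1, …, 1)`, with `ε` on the tensor factor of (zero-based) index `i`. -/
def counitAt (H : C) [ComonObj H] :
    (n : ℕ) → Fin (n + 1) → (tensorPow H (n + 1) ⟶ tensorPow H n)
  | 0, _ => ε[H] ▷ tensorPow H 0 ≫ (λ_ (tensorPow H 0)).hom
  | n + 1, i => Fin.cases (motive := fun _ => tensorPow H (n + 2) ⟶ tensorPow H (n + 1))
      (ε[H] ▷ tensorPow H (n + 1) ≫ (λ_ (tensorPow H (n + 1))).hom)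
      (fun k => H ◁ counitAt H n k) i

/-- `(1, …, 1, σ) : H^{⊗n} ⟶ H^{⊗(n+1)}`. -/
def appendLast (H : C) (σ : 𝟙_ C ⟶ H) : (n : ℕ) → (tensorPow H n ⟶ tensorPow H (n + 1))
  | 0 => σ ≫ (ρ_ H).inv
  | n + 1 => H ◁ appendLast H σ n

/-- `(η, 1, …, 1) : H^{⊗n} ⟶ H^{⊗(n+1)}`. -/
def unitFirst (H : C) [MonObj H] (n : ℕ) : tensorPow H n ⟶ tensorPow H (n + 1) :=
  (λ_ (tensorPow H n)).inv ≫ η[H] ▷ tensorPow H n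

variable [BraidedCategory C]

/-- The `δ`-twisted antipode `S̃ = (δ ⊗ S) Δ`. -/
def twistedAntipode (H : C) [HopfObj H] (δ : H ⟶ 𝟙_ C) : H ⟶ H :=
  Δ[H] ≫ (δ ⊗ₘ 𝒮[H]) ≫ (λ_ H).hom

/-- A character of `H`: an algebra map `δ : H ⟶ I`. -/
structure IsCharacter (H : C) [HopfObj H] (δ : H ⟶ 𝟙_ C) : Prop where
  mul : μ[H] ≫ δ = (δ ⊗ₘ δ) ≫ (λ_ (𝟙_ C)).hom
  one : η[H] ≫ δ = 𝟙 (𝟙_ C)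

/-- A co-character of `H`: a coalgebra map `σ : I ⟶ H`. -/
structure IsCocharacter (H : C) [HopfObj H] (σ : 𝟙_ C ⟶ H) : Prop where
  comul : σ ≫ Δ[H] = (λ_ (𝟙_ C)).inv ≫ (σ ⊗ₘ σ)
  counit : σ ≫ ε[H] = 𝟙 (𝟙_ C)

/-- A braided modular pair in involution `(δ, σ)`: a character and a co-character with `δ σ = 1_I`
and `m (m ⊗ 1) (S σ ⊗ S̃² ⊗ σ) = 1_H`. -/
structure IsModularPairInInvolution (H : C) [HopfObj H] (δ : H ⟶ 𝟙_ C) (σ : 𝟙_ C ⟶ H) :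
    Prop where
  character : IsCharacter H δ
  cocharacter : IsCocharacter H σ
  modular : σ ≫ δ = 𝟙 (𝟙_ C)
  involution :
    (λ_ H).inv ≫ (ρ_ (𝟙_ C ⊗ H)).inv ≫
      (((σ ≫ 𝒮[H]) ⊗ₘ (twistedAntipode H δ ≫ twistedAntipode H δ)) ⊗ₘ σ) ≫
        μ[H] ▷ H ≫ μ[H] = 𝟙 H

/-- The cofaces `δ_i : H^{⊗n} ⟶ H^{⊗(n+1)}`, `0 ≤ i ≤ n + 1`: `(η, 1, …, 1)` for `i = 0`,
`Δ` on the `i`-th factor for `1 ≤ i ≤ n`, and `(1, …, 1, σ)` for `i = n + 1`. -/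
def coface (H : C) [HopfObj H] (σ : 𝟙_ C ⟶ H) (n : ℕ) (i : Fin (n + 2)) :
    tensorPow H n ⟶ tensorPow H (n + 1) :=
  Fin.cases (motive := fun _ => tensorPow H n ⟶ tensorPow H (n + 1)) (unitFirst H n)
    (fun k => Fin.lastCases (motive := fun _ => tensorPow H n ⟶ tensorPow H (n + 1))
      (appendLast H σ n) (fun l => comulAt H n l) k) i

/-- The codegeneracies `σ_i : H^{⊗(n+1)} ⟶ H^{⊗n}`, `0 ≤ i ≤ n`: `ε` on the `(i+1)`-th factor. -/
def codegeneracy (H : C) [HopfObj H] (n : ℕ) (i : Fin (n + 1)) :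
    tensorPow H (n + 1) ⟶ tensorPow H n :=
  counitAt H n i

/-- The cyclic operators: `τ_0 = 1_I` and `τ_n = m_n (Δ^{n-1} S̃, 1_{H^{n-1}}, σ)` for `n ≥ 1`. -/
def cyclicOp (H : C) [HopfObj H] (δ : H ⟶ 𝟙_ C) (σ : 𝟙_ C ⟶ H) :
    (n : ℕ) → (tensorPow H n ⟶ tensorPow H n)
  | 0 => 𝟙 (𝟙_ C)
  | n + 1 => ((twistedAntipode H δ ≫ iterComul H n) ⊗ₘ appendLast H σ n) ≫ mulPow H (n + 1)

end BraidedHopf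

/-!
The morphism `m_n` is the product of the braided tensor power of the monoid `H`, and for this
monoid structure the iterated comultiplications and the insertions of `Δ` and `ε` are morphisms of
monoids. Since `τ_n` is the product of `Δ^{n-1} S̃` and `(1, …, 1, σ)`, the relations for the inner
cofaces and codegeneracies follow by passing such a morphism through a product, and `τ_n δ_0 = δ_n`
says that `Δ^{n-1} S̃` preserves the unit.

Two relations are of a different kind. In `τ_{n+1} δ_1`, the identity `Δ S̃ = (S ⊗ S̃) ψ Δ`
produces a factor `S` of the first coproduct component of `H` next to an identity factor, and the
antipode axiom cancels the pair. In `σ_n τ_{n+1}²`, the map `w = Δ^{n-1} S̃` reverses products up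
to the braiding, so that the outer operator turns the factor `Δ^n S̃` of the inner one into `m_n
(w, 1) Δ^n S̃`; this collapses to `η ε` because `m_n (w, 1) Δ^n = η δ` and `δ S̃ = ε`.
-/

-- Lets `rw` see through `H^{⊗(n+1)} = H ⊗ H^{⊗n}`.
attribute [reducible] BraidedHopf.tensorPow

namespace BraidedHopf

section FirstFactor

variable {C : Type u} [Category.{v} C] [MonoidalCategory C] (H : C) (X : C) {Y : C}

/-- `η ⊗ 1_X`, up to the unit constraint; here and below, `X` stands for the tensor factors that are
left alone. -/
def unitHead [MonObj H] : X ⟶ H ⊗ X :=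
  (λ_ X).inv ≫ η[H] ▷ X

/-- `Δ ⊗ 1_X`, up to the associativity constraint. -/
def comulHead [ComonObj H] : H ⊗ X ⟶ H ⊗ H ⊗ X :=
  Δ[H] ▷ X ≫ (α_ H H X).hom

/-- `ε ⊗ 1_X`, up to the unit constraint. -/
def counitHead [ComonObj H] : H ⊗ X ⟶ X :=
  ε[H] ▷ X ≫ (λ_ X).hom

variable {X}

lemma comp_unitHead [MonObj H] (f : X ⟶ Y) : f ≫ unitHead H Y = unitHead H X ≫ H ◁ f := by
  rw [unitHead, leftUnitor_inv_naturality_assoc, whisker_exchange, unitHead, Category.assoc]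

lemma whiskerLeft_comp_comulHead [ComonObj H] (f : X ⟶ Y) :
    H ◁ f ≫ comulHead H Y = comulHead H X ≫ H ◁ H ◁ f := by
  simp [comulHead, whisker_exchange_assoc]

lemma whiskerLeft_comp_counitHead [ComonObj H] (f : X ⟶ Y) :
    H ◁ f ≫ counitHead H Y = counitHead H X ≫ f := by
  simp [counitHead, whisker_exchange_assoc]

variable (X)

lemma comulHead_comp_whiskerLeft_comulHead [ComonObj H] :
    comulHead H X ≫ H ◁ comulHead H X = comulHead H X ≫ comulHead H (H ⊗ X) := by
  calc comulHead H X ≫ H ◁ comulHead H X =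
        (Δ[H] ≫ H ◁ Δ[H]) ▷ X ≫ (α_ H (H ⊗ H) X).hom ≫ H ◁ (α_ H H X).hom := by
        unfold comulHead; monoidal
    _ = comulHead H X ≫ comulHead H (H ⊗ X) := by
        rw [ComonObj.comul_assoc]; unfold comulHead; monoidal

lemma comulHead_comp_counitHead [ComonObj H] :
    comulHead H X ≫ counitHead H (H ⊗ X) = 𝟙 (H ⊗ X) := by
  calc comulHead H X ≫ counitHead H (H ⊗ X) = (Δ[H] ≫ ε[H] ▷ H) ▷ X ≫ (λ_ H).hom ▷ X := by
        unfold comulHead counitHead; monoidal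
    _ = 𝟙 (H ⊗ X) := by rw [ComonObj.counit_comul]; monoidal

lemma comulHead_comp_whiskerLeft_counitHead [ComonObj H] :
    comulHead H X ≫ H ◁ counitHead H X = 𝟙 (H ⊗ X) := by
  calc comulHead H X ≫ H ◁ counitHead H X = (Δ[H] ≫ H ◁ ε[H]) ▷ X ≫ (ρ_ H).hom ▷ X := by
        unfold comulHead counitHead; monoidal
    _ = 𝟙 (H ⊗ X) := by rw [ComonObj.comul_counit]; monoidal

variable [BraidedCategory C] [BimonObj H]

lemma unitHead_comp_comulHead :
    unitHead H X ≫ comulHead H X = unitHead H X ≫ unitHead H (H ⊗ X) := by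
  calc unitHead H X ≫ comulHead H X = (λ_ X).inv ≫ (η[H] ≫ Δ[H]) ▷ X ≫ (α_ H H X).hom := by
        unfold unitHead comulHead; monoidal
    _ = unitHead H X ≫ unitHead H (H ⊗ X) := by
        rw [Bimon.one_comul, tensorHom_def']; unfold unitHead; monoidal

lemma unitHead_comp_counitHead : unitHead H X ≫ counitHead H X = 𝟙 X := by
  calc unitHead H X ≫ counitHead H X = (λ_ X).inv ≫ (η[H] ≫ ε[H]) ▷ X ≫ (λ_ X).hom := by
        unfold unitHead counitHead; monoidal
    _ = 𝟙 X := by rw [BimonObj.one_counit]; simp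

end FirstFactor

section Cosimplicial

variable {C : Type u} [Category.{v} C] [MonoidalCategory C] (H : C)

lemma comulAt_succ [ComonObj H] (n : ℕ) (i : Fin n) :
    comulAt H (n + 1) i.succ = H ◁ comulAt H n i := rfl

lemma counitAt_zero [ComonObj H] (n : ℕ) :
    counitAt H n 0 = counitHead H (tensorPow H n) := by
  cases n <;> rfl

lemma counitAt_succ [ComonObj H] (n : ℕ) (i : Fin (n + 1)) :
    counitAt H (n + 1) i.succ = H ◁ counitAt H n i := rfl

lemma counitAt_comp_counitAt [ComonObj H] (n : ℕ) (i j : Fin (n + 1)) (hij : i ≤ j) :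
    counitAt H (n + 1) i.castSucc ≫ counitAt H n j =
      counitAt H (n + 1) j.succ ≫ counitAt H n i := by
  induction n with
  | zero =>
    obtain rfl := Fin.fin_one_eq_zero i
    obtain rfl := Fin.fin_one_eq_zero j
    rw [counitAt_succ, counitAt_zero, Fin.castSucc_zero, counitAt_zero, whiskerLeft_comp_counitHead]
  | succ n ih =>
    cases i using Fin.cases with
    | zero =>
      rw [counitAt_succ, Fin.castSucc_zero, counitAt_zero, counitAt_zero,
        whiskerLeft_comp_counitHead]
    | succ i =>
      cases j using Fin.cases with
      | zero => simp at hij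
      | succ j =>
        simp only [← Fin.succ_castSucc, counitAt_succ, ← whiskerLeft_comp,
          ih i j (Fin.succ_le_succ_iff.mp hij)]

end Cosimplicial

section Coface

variable {C : Type u} [Category.{v} C] [MonoidalCategory C] [BraidedCategory C] (H : C) [HopfObj H]
  (σ : 𝟙_ C ⟶ H)

lemma coface_zero (n : ℕ) : coface H σ n 0 = unitHead H (tensorPow H n) := rfl

lemma coface_one_zero : coface H σ 0 1 = σ ≫ (ρ_ H).inv := rfl

lemma coface_castSucc_succ (n : ℕ) (i : Fin n) :
    coface H σ n i.castSucc.succ = comulAt H n i := by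
  simp [coface]

lemma coface_last (n : ℕ) : coface H σ n (Fin.last (n + 1)) = appendLast H σ n := by
  simp [coface, ← Fin.succ_last]

lemma coface_one (n : ℕ) : coface H σ (n + 1) 1 = comulHead H (tensorPow H n) :=
  coface_castSucc_succ H σ (n + 1) 0

lemma coface_succ_succ (n : ℕ) (i : Fin (n + 1)) :
    coface H σ (n + 1) i.succ.succ = H ◁ coface H σ n i.succ := by
  cases i using Fin.lastCases with
  | last => rw [Fin.succ_last, Fin.succ_last, coface_last, coface_last]; rfl
  | cast i =>
    rw [coface_castSucc_succ, Fin.succ_castSucc, coface_castSucc_succ, comulAt_succ]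

variable {H σ}

lemma IsCocharacter.coface_one_comp_coface_two (hσ : IsCocharacter H σ) :
    coface H σ 0 1 ≫ coface H σ 1 2 = coface H σ 0 1 ≫ coface H σ 1 1 := by
  calc coface H σ 0 1 ≫ coface H σ 1 2 = ((λ_ (𝟙_ C)).inv ≫ (σ ⊗ₘ σ)) ≫ H ◁ (ρ_ H).inv := by
        rw [show coface H σ 1 2 = H ◁ (σ ≫ (ρ_ H).inv) from rfl, coface_one_zero,
          MonoidalCategory.tensorHom_def]
        monoidal
    _ = coface H σ 0 1 ≫ coface H σ 1 1 := by
        rw [← hσ.comul, coface_one_zero, coface_one]; unfold comulHead; monoidal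

lemma IsCocharacter.coface_succ_comp_coface_succ_succ (hσ : IsCocharacter H σ) (n : ℕ)
    (i j : Fin (n + 1)) (hij : i ≤ j) :
    coface H σ n i.succ ≫ coface H σ (n + 1) j.succ.succ =
      coface H σ n j.succ ≫ coface H σ (n + 1) i.castSucc.succ := by
  induction n with
  | zero =>
    obtain rfl := Fin.fin_one_eq_zero i
    obtain rfl := Fin.fin_one_eq_zero j
    exact hσ.coface_one_comp_coface_two
  | succ n ih =>
    rw [coface_succ_succ]
    cases i using Fin.cases with
    | zero =>
      rw [Fin.castSucc_zero, Fin.succ_zero_eq_one, coface_one, Fin.succ_zero_eq_one, coface_one]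
      cases j using Fin.cases with
      | zero => rw [Fin.succ_zero_eq_one, coface_one, comulHead_comp_whiskerLeft_comulHead]
      | succ j => rw [coface_succ_succ, whiskerLeft_comp_comulHead]
    | succ i =>
      cases j using Fin.cases with
      | zero => simp at hij
      | succ j =>
        rw [coface_succ_succ, ← Fin.succ_castSucc, coface_succ_succ, coface_succ_succ,
          ← whiskerLeft_comp, ← coface_succ_succ, ih i j (Fin.succ_le_succ_iff.mp hij),
          whiskerLeft_comp, coface_succ_succ]

lemma IsCocharacter.coface_comp_coface_succ (hσ : IsCocharacter H σ) (n : ℕ) (i j : Fin (n + 2))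
    (hij : i ≤ j) :
    coface H σ n i ≫ coface H σ (n + 1) j.succ =
      coface H σ n j ≫ coface H σ (n + 1) i.castSucc := by
  cases i using Fin.cases with
  | zero =>
    rw [Fin.castSucc_zero, coface_zero, coface_zero]
    cases j using Fin.cases with
    | zero => rw [Fin.succ_zero_eq_one, coface_one, coface_zero, unitHead_comp_comulHead]
    | succ j => rw [coface_succ_succ, comp_unitHead]
  | succ i =>
    cases j using Fin.cases with
    | zero => simp at hij
    | succ j =>
      exact hσ.coface_succ_comp_coface_succ_succ n i j (Fin.succ_le_succ_iff.mp hij)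

variable (H σ)

lemma coface_castSucc_comp_counitAt_succ (n : ℕ) (i : Fin (n + 2)) (j : Fin (n + 1))
    (hij : i ≤ j.castSucc) :
    coface H σ (n + 1) i.castSucc ≫ counitAt H (n + 1) j.succ =
      counitAt H n j ≫ coface H σ n i := by
  induction n with
  | zero =>
    obtain rfl := Fin.fin_one_eq_zero j
    obtain rfl : i = 0 := Fin.le_zero_iff.mp hij
    rw [Fin.castSucc_zero, coface_zero, coface_zero, counitAt_succ, comp_unitHead]
  | succ n ih =>
    rw [counitAt_succ]
    cases i using Fin.cases with
    | zero => rw [Fin.castSucc_zero, coface_zero, coface_zero, comp_unitHead]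
    | succ i =>
      cases j using Fin.cases with
      | zero => simp at hij
      | succ j =>
        rw [counitAt_succ]
        cases i using Fin.cases with
        | zero =>
          rw [Fin.succ_zero_eq_one, Fin.castSucc_one, coface_one, coface_one,
            whiskerLeft_comp_comulHead]
        | succ i =>
          rw [← Fin.succ_castSucc, ← Fin.succ_castSucc, coface_succ_succ, coface_succ_succ,
            ← whiskerLeft_comp, ← counitAt_succ, Fin.succ_castSucc,
            ih i.succ j (Fin.succ_le_succ_iff.mp hij), whiskerLeft_comp, counitAt_succ]

lemma coface_castSucc_comp_counitAt (n : ℕ) (i : Fin (n + 1)) :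
    coface H σ n i.castSucc ≫ counitAt H n i = 𝟙 (tensorPow H n) := by
  induction n with
  | zero =>
    obtain rfl := Fin.fin_one_eq_zero i
    exact unitHead_comp_counitHead H _
  | succ n ih =>
    cases i using Fin.cases with
    | zero => exact unitHead_comp_counitHead H _
    | succ i =>
      rw [counitAt_succ]
      cases i using Fin.cases with
      | zero =>
        rw [Fin.succ_zero_eq_one, Fin.castSucc_one, coface_one, counitAt_zero,
          comulHead_comp_whiskerLeft_counitHead]
      | succ i =>
        rw [← Fin.succ_castSucc, ← Fin.succ_castSucc, coface_succ_succ, ← whiskerLeft_comp,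
          Fin.succ_castSucc, ih, whiskerLeft_id]

variable {H σ} in
lemma IsCocharacter.coface_succ_comp_counitAt (hσ : IsCocharacter H σ) (n : ℕ) (i : Fin (n + 1)) :
    coface H σ n i.succ ≫ counitAt H n i = 𝟙 (tensorPow H n) := by
  induction n with
  | zero =>
    obtain rfl := Fin.fin_one_eq_zero i
    calc coface H σ 0 1 ≫ counitAt H 0 0 = σ ≫ ε[H] := by
          rw [coface_one_zero, counitAt_zero]; unfold counitHead; monoidal
      _ = 𝟙 (𝟙_ C) := hσ.counit
  | succ n ih =>
    cases i using Fin.cases with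
    | zero => rw [Fin.succ_zero_eq_one, coface_one, counitAt_zero, comulHead_comp_counitHead]
    | succ i => rw [coface_succ_succ, counitAt_succ, ← whiskerLeft_comp, ih, whiskerLeft_id]

lemma coface_succ_comp_counitAt_castSucc (n : ℕ) (i : Fin (n + 2)) (j : Fin (n + 1))
    (hij : j.castSucc < i) :
    coface H σ (n + 1) i.succ ≫ counitAt H (n + 1) j.castSucc =
      counitAt H n j ≫ coface H σ n i := by
  induction n with
  | zero =>
    obtain rfl := Fin.fin_one_eq_zero j
    obtain rfl : i = 1 := Fin.eq_one_of_ne_zero i hij.ne'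
    exact whiskerLeft_comp_counitHead H _
  | succ n ih =>
    cases i using Fin.cases with
    | zero => simp at hij
    | succ i =>
      rw [coface_succ_succ]
      cases j using Fin.cases with
      | zero => exact whiskerLeft_comp_counitHead H _
      | succ j =>
        cases i using Fin.cases with
        | zero => exact absurd hij (by simp)
        | succ i =>
          rw [← Fin.succ_castSucc, counitAt_succ, ← whiskerLeft_comp,
            ih i.succ j (Fin.succ_lt_succ_iff.mp hij), whiskerLeft_comp, counitAt_succ,
            coface_succ_succ]

end Coface

section Shuffle

variable {C : Type u} [Category.{v} C] [MonoidalCategory C]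

/-- `concatIso` with its codomain transported along `b + a = N`, so that inductions may bring `N` to
the form `N' + 1`. -/
def concat (H : C) (a b N : ℕ) (h : b + a = N) : tensorPow H a ⊗ tensorPow H b ⟶ tensorPow H N :=
  (concatIso H b a).hom ≫ eqToHom (congrArg (tensorPow H) h)

lemma concat_zero (H : C) (b : ℕ) : concat H 0 b b b.add_zero = (λ_ (tensorPow H b)).hom :=
  Category.comp_id _

lemma concat_succ (H : C) (a b N : ℕ) (h : b + a = N) :
    concat H (a + 1) b (N + 1) (congrArg (· + 1) h) =
      (α_ H (tensorPow H a) (tensorPow H b)).hom ≫ H ◁ concat H a b N h := by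
  subst h
  simp [concat, concatIso]

variable [BraidedCategory C]

/-- The braiding of the first two of three tensor factors. -/
def braidHead (X Y Z : C) : X ⊗ Y ⊗ Z ⟶ Y ⊗ X ⊗ Z :=
  (α_ X Y Z).inv ≫ (β_ X Y).hom ▷ Z ≫ (α_ Y X Z).hom

lemma whiskerLeft_whiskerLeft_comp_braidHead (X Y : C) {Z W : C} (f : Z ⟶ W) :
    X ◁ Y ◁ f ≫ braidHead X Y W = braidHead X Y Z ≫ Y ◁ X ◁ f := by
  calc X ◁ Y ◁ f ≫ braidHead X Y W =
        (α_ X Y Z).inv ≫ ((X ⊗ Y) ◁ f ≫ (β_ X Y).hom ▷ W) ≫ (α_ Y X W).hom := by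
        unfold braidHead; monoidal
    _ = braidHead X Y Z ≫ Y ◁ X ◁ f := by
        rw [whisker_exchange]; unfold braidHead; monoidal

lemma braidHead_unit_left (Y Z : C) :
    braidHead (𝟙_ C) Y Z ≫ Y ◁ (λ_ Z).hom = (λ_ (Y ⊗ Z)).hom := by
  rw [braidHead, braiding_tensorUnit_left]
  monoidal

lemma braidHead_tensor_left (W X Y Z : C) :
    braidHead (W ⊗ X) Y Z ≫ Y ◁ (α_ W X Z).hom =
      (α_ W X (Y ⊗ Z)).hom ≫ W ◁ braidHead X Y Z ≫ braidHead W Y (X ⊗ Z) := by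
  simp only [braidHead, BraidedCategory.braiding_tensor_left_hom]
  monoidal

lemma tensorμ_eq_whiskerLeft_braidHead (W X Y Z : C) :
    tensorμ W X Y Z =
      (α_ W X (Y ⊗ Z)).hom ≫ W ◁ braidHead X Y Z ≫ (α_ W Y (X ⊗ Z)).inv := by
  rw [tensorμ, braidHead]
  monoidal

variable (H : C)

lemma braidPairs_zero (N : ℕ) : braidPairs H N 0 = 𝟙 (tensorPow H N) := by
  rcases N with _ | _ | N <;> rfl

lemma braidPairs_succ (N k : ℕ) : braidPairs H (N + 2) (k + 1) =
    braidHead H H (tensorPow H N) ≫ H ◁ H ◁ braidPairs H N k := by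
  rw [braidPairs, MonoidalCategory.tensorHom_def, braidHead]
  monoidal

lemma braidPairs_one (N : ℕ) : braidPairs H (N + 2) 1 = braidHead H H (tensorPow H N) := by
  rw [braidPairs_succ, braidPairs_zero, whiskerLeft_id, whiskerLeft_id, Category.comp_id]

lemma braidRow_zero (N k : ℕ) : braidRow H N 0 k = braidPairs H N k := by
  cases N <;> rfl

lemma braidRow_succ (N j k : ℕ) : braidRow H (N + 1) (j + 1) k = H ◁ braidRow H N j k := rfl

lemma braidRow_zero_right (N j : ℕ) : braidRow H N j 0 = 𝟙 (tensorPow H N) := by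
  induction j generalizing N with
  | zero => rw [braidRow_zero, braidPairs_zero]
  | succ j ih =>
    cases N with
    | zero => rfl
    | succ N => rw [braidRow_succ, ih, whiskerLeft_id]

lemma braidRow_one_left (j k : ℕ) : braidRow H 1 j k = 𝟙 (tensorPow H 1) := by
  rcases j with _ | _ | _
  · rfl
  all_goals exact whiskerLeft_id H (𝟙_ C)

lemma braidRow_succ_right (N r k : ℕ) :
    braidRow H (N + 2) r (k + 1) = braidRow H (N + 2) r 1 ≫ braidRow H (N + 2) (r + 2) k := by
  induction r generalizing N with
  | zero =>
    rw [braidRow_zero, braidRow_zero, braidPairs_succ, braidPairs_one, braidRow_succ,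
      braidRow_succ, braidRow_zero]
  | succ r ih =>
    rw [braidRow_succ, braidRow_succ H _ r 1, braidRow_succ H _ (r + 2), ← whiskerLeft_comp]
    cases N with
    | zero => rw [braidRow_one_left, braidRow_one_left, braidRow_one_left, Category.comp_id]
    | succ N => rw [ih]

lemma braidRow_comp_braidRow_one (N i j k : ℕ) (hij : i + 2 ≤ j) :
    braidRow H N j k ≫ braidRow H N i 1 = braidRow H N i 1 ≫ braidRow H N j k := by
  obtain ⟨j, rfl⟩ := Nat.exists_eq_add_of_le' hij
  rw [← Nat.add_assoc]
  induction i generalizing N with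
  | zero =>
    rcases N with _ | _ | N
    · rfl
    · rw [braidRow_one_left, braidRow_one_left]
    · rw [braidRow_zero, braidPairs_one]
      exact whiskerLeft_whiskerLeft_comp_braidHead H H _
  | succ i ih =>
    cases N with
    | zero => rfl
    | succ N =>
      rw [braidRow_succ, braidRow_succ, ← whiskerLeft_comp, ← whiskerLeft_comp]
      exact congrArg (H ◁ ·) (ih N (by omega))

/-- The composite of adjacent braidings that carries the factor of (zero-based) index `a` of
`H^{⊗N}` to the front. -/
def braidToFront (N : ℕ) : ℕ → (tensorPow H N ⟶ tensorPow H N)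
  | 0 => 𝟙 (tensorPow H N)
  | a + 1 => braidRow H N a 1 ≫ braidToFront N a

lemma braidToFront_succ_succ (N a : ℕ) : braidToFront H (N + 2) (a + 1) =
    H ◁ braidToFront H (N + 1) a ≫ braidHead H H (tensorPow H N) := by
  induction a with
  | zero =>
    rw [braidToFront, braidToFront, braidToFront, braidRow_zero, braidPairs_one, whiskerLeft_id,
      Category.comp_id, Category.id_comp]
  | succ a ih =>
    rw [braidToFront, ih, braidRow_succ, braidToFront, whiskerLeft_comp, Category.assoc]

lemma braidRow_comp_braidToFront (N a j k : ℕ) (haj : a < j) :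
    braidRow H N j k ≫ braidToFront H N a = braidToFront H N a ≫ braidRow H N j k := by
  induction a with
  | zero => rw [braidToFront, Category.comp_id, Category.id_comp]
  | succ a ih =>
    rw [braidToFront, ← Category.assoc, braidRow_comp_braidRow_one H N a j k haj, Category.assoc,
      ih (Nat.lt_of_succ_lt haj), Category.assoc]

lemma concat_comp_braidToFront (a b N : ℕ) (h : b + a = N) :
    concat H a (b + 1) (N + 1) (by omega) ≫ braidToFront H (N + 1) a =
      braidHead (tensorPow H a) H (tensorPow H b) ≫ H ◁ concat H a b N h := by
  induction a generalizing N with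
  | zero =>
    subst h
    rw [braidToFront, Category.comp_id]
    exact (concat_zero H (b + 1)).trans ((braidHead_unit_left H (tensorPow H b)).symm.trans
      (congrArg (_ ≫ H ◁ ·) (concat_zero H b).symm))
  | succ a ih =>
    obtain ⟨N, rfl⟩ : ∃ M, N = M + 1 := ⟨b + a, h.symm⟩
    have hN : b + a = N := Nat.succ.inj h
    rw [concat_succ H a (b + 1) (N + 1) (by omega), braidToFront_succ_succ, Category.assoc,
      ← whiskerLeft_comp_assoc, ih N hN, concat_succ H a b N hN, whiskerLeft_comp,
      whiskerLeft_comp, reassoc_of% braidHead_tensor_left, Category.assoc,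
      whiskerLeft_whiskerLeft_comp_braidHead]

lemma braidProd_succ (n r : ℕ) (hr : r ≤ n) : braidProd H (n + 1) r =
    H ◁ (braidToFront H (2 * n + 1) r ≫ H ◁ braidProd H n r) := by
  induction r with
  | zero =>
    rw [braidToFront, braidProd, braidProd, whiskerLeft_id, Category.comp_id, whiskerLeft_id]
    rfl
  | succ r ih =>
    obtain ⟨k, rfl⟩ := Nat.exists_eq_add_of_lt hr
    have row_split : braidRow H (2 * (r + k + 1) + 1) r (k + 1) =
        braidRow H (2 * (r + k + 1) + 1) r 1 ≫ braidRow H (2 * (r + k + 1) + 1) (r + 2) k :=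
      braidRow_succ_right H (2 * (r + k) + 1) r k
    have copies : r + k + 1 + 1 - (r + 1) = k + 1 := by omega
    have copies' : r + k + 1 - (r + 1) = k := by omega
    calc braidProd H (r + k + 1 + 1) (r + 1)
        = H ◁ (braidRow H (2 * (r + k + 1) + 1) r (k + 1) ≫
            braidToFront H (2 * (r + k + 1) + 1) r ≫ H ◁ braidProd H (r + k + 1) r) := by
          rw [braidProd, ih (Nat.le_of_succ_le hr), copies]
          exact (whiskerLeft_comp ..).symm
      _ = H ◁ (braidToFront H (2 * (r + k + 1) + 1) (r + 1) ≫
            H ◁ braidProd H (r + k + 1) (r + 1)) := by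
          rw [row_split, Category.assoc, reassoc_of% braidRow_comp_braidToFront H _ r (r + 2) k
            (by omega), braidToFront, braidProd, copies', braidRow_succ]
          simp only [whiskerLeft_comp, Category.assoc]

lemma shuffle_eq_braidProd (n : ℕ) : shuffle H n = braidProd H n n := by
  cases n with
  | zero => rfl
  | succ n => rw [shuffle, braidProd, Nat.sub_self, braidRow_zero_right, Category.id_comp]; rfl

lemma shuffle_succ (n : ℕ) :
    shuffle H (n + 1) = H ◁ (braidToFront H (2 * n + 1) n ≫ H ◁ shuffle H n) := by
  rw [shuffle_eq_braidProd H n, ← braidProd_succ H n n le_rfl]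
  rfl

variable [MonObj H]

lemma mulPow_eq_concat_comp (n : ℕ) :
    mulPow H n = concat H n n (2 * n) (two_mul n).symm ≫ shuffle H n ≫ mulPairs H n := by
  rw [concat, Category.assoc, mulPow]

lemma mulPow_zero : mulPow H 0 = (λ_ (𝟙_ C)).hom := by
  simp [mulPow, shuffle, braidProd, mulPairs, concatIso]

lemma mulPow_succ (n : ℕ) : mulPow H (n + 1) =
    tensorμ H (tensorPow H n) H (tensorPow H n) ≫ (μ[H] ⊗ₘ mulPow H n) := by
  have two_mul_eq : n + n = 2 * n := (two_mul n).symm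
  calc mulPow H (n + 1)
      = ((α_ H (tensorPow H n) (H ⊗ tensorPow H n)).hom ≫
            H ◁ concat H n (n + 1) (2 * n + 1) (by omega)) ≫
          H ◁ (braidToFront H (2 * n + 1) n ≫ H ◁ shuffle H n) ≫
            (α_ H H (tensorPow H (2 * n))).inv ≫ (μ[H] ⊗ₘ mulPairs H n) := by
        rw [mulPow_eq_concat_comp, shuffle_succ, ← concat_succ H n (n + 1)]
        rfl
    _ = (α_ H (tensorPow H n) (H ⊗ tensorPow H n)).hom ≫
          H ◁ (concat H n (n + 1) (2 * n + 1) (by omega) ≫ braidToFront H (2 * n + 1) n) ≫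
            H ◁ H ◁ shuffle H n ≫
              (α_ H H (tensorPow H (2 * n))).inv ≫ (μ[H] ⊗ₘ mulPairs H n) := by
        simp only [whiskerLeft_comp, Category.assoc]
    _ = tensorμ H (tensorPow H n) H (tensorPow H n) ≫ (μ[H] ⊗ₘ mulPow H n) := by
        rw [concat_comp_braidToFront H n n (2 * n) two_mul_eq, mulPow_eq_concat_comp,
          tensorμ_eq_whiskerLeft_braidHead]
        simp only [MonoidalCategory.tensorHom_def']
        monoidal

end Shuffle

section TensorMul

variable {C : Type u} [Category.{v} C] [MonoidalCategory C] {X Y Z A B H : C}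

/-- The product `m (f ⊗ g)` of two morphisms into a monoid. -/
def tensorMul [MonObj A] (f : X ⟶ A) (g : Y ⟶ A) : X ⊗ Y ⟶ A :=
  (f ⊗ₘ g) ≫ μ[A]

lemma tensorMul_comp [MonObj A] [MonObj B] (f : X ⟶ A) (g : Y ⟶ A) (h : A ⟶ B) [IsMonHom h] :
    tensorMul f g ≫ h = tensorMul (f ≫ h) (g ≫ h) := by
  simp only [tensorMul, Category.assoc, IsMonHom.mul_hom, tensorHom_comp_tensorHom_assoc]

lemma whiskerLeft_comp_tensorMul [MonObj A] (h : Z ⟶ Y) (f : X ⟶ A) (g : Y ⟶ A) :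
    X ◁ h ≫ tensorMul f g = tensorMul f (h ≫ g) :=
  whiskerLeft_comp_tensorHom_assoc ..

lemma whiskerRight_comp_tensorMul [MonObj A] (h : Z ⟶ X) (f : X ⟶ A) (g : Y ⟶ A) :
    h ▷ Y ≫ tensorMul f g = tensorMul (h ≫ f) g :=
  whiskerRight_comp_tensorHom_assoc ..

lemma tensorMul_tensorMul [MonObj A] (f : X ⟶ A) (g : Y ⟶ A) (h : Z ⟶ A) :
    tensorMul (tensorMul f g) h = (α_ X Y Z).hom ≫ tensorMul f (tensorMul g h) := by
  simp only [tensorMul]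
  rw [← tensorHom_comp_whiskerRight, Category.assoc, MonObj.mul_assoc,
    ← tensorHom_comp_whiskerLeft, Category.assoc, associator_naturality_assoc]

lemma tensorMul_unit_left [MonObj A] (e : X ⟶ 𝟙_ C) (f : Y ⟶ A) :
    tensorMul (e ≫ η[A]) f = e ▷ Y ≫ (λ_ Y).hom ≫ f := by
  rw [← whiskerRight_comp_tensorMul, tensorMul, MonoidalCategory.tensorHom_def', Category.assoc,
    MonObj.one_mul, leftUnitor_naturality]

lemma tensorMul_unit_right [MonObj A] (f : X ⟶ A) (e : Y ⟶ 𝟙_ C) :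
    tensorMul f (e ≫ η[A]) = X ◁ e ≫ (ρ_ X).hom ≫ f := by
  rw [← whiskerLeft_comp_tensorMul, tensorMul, MonoidalCategory.tensorHom_def, Category.assoc,
    MonObj.mul_one, rightUnitor_naturality]

lemma unitHead_comp_tensorMul [MonObj H] [MonObj A] (f : H ⟶ A) (hf : η[H] ≫ f = η[A])
    (g : X ⟶ A) : unitHead H X ≫ tensorMul f g = g := by
  rw [unitHead, Category.assoc, whiskerRight_comp_tensorMul, hf, ← Category.id_comp η[A],
    tensorMul_unit_left, id_whiskerRight, Category.id_comp, Iso.inv_hom_id_assoc]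

lemma comulHead_comp_tensorMul [ComonObj H] [MonObj A] (f g : H ⟶ A) (h : X ⟶ A) :
    comulHead H X ≫ tensorMul f (tensorMul g h) = tensorMul (Δ[H] ≫ tensorMul f g) h := by
  rw [← whiskerRight_comp_tensorMul, tensorMul_tensorMul, comulHead, Category.assoc]

end TensorMul

section TensorMon

variable {C : Type u} [Category.{v} C] [MonoidalCategory C] [BraidedCategory C] (A B : C)

/-- `1_A ⊗ η`, up to the unit constraint: the first inclusion of monoids `A ⟶ A ⊗ B`, the second
one being `unitHead A B`. -/
def unitTail [MonObj B] : A ⟶ A ⊗ B :=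
  (ρ_ A).inv ≫ A ◁ η[B]

variable [MonObj A] [MonObj B]

instance isMonHom_one : IsMonHom η[A] where
  mul_hom := by simp [unitors_equal]

instance isMonHom_unitHead : IsMonHom (unitHead A B) := by
  unfold unitHead
  infer_instance

instance isMonHom_unitTail : IsMonHom (unitTail A B) := by
  unfold unitTail
  infer_instance

lemma tensorMul_unitTail_unitHead : tensorMul (unitTail A B) (unitHead A B) = 𝟙 (A ⊗ B) := by
  calc tensorMul (unitTail A B) (unitHead A B)
      = ((ρ_ A).inv ⊗ₘ (λ_ B).inv) ≫ tensorμ A (𝟙_ C) (𝟙_ C) B ≫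
          (A ◁ η[A] ≫ μ[A] ⊗ₘ η[B] ▷ B ≫ μ[B]) := by
        simp only [tensorMul, MonObj.tensorObj.mul_def, unitTail, unitHead,
          ← tensorHom_comp_tensorHom, ← id_tensorHom, ← tensorHom_id, Category.assoc,
          tensorμ_natural_assoc]
    _ = 𝟙 (A ⊗ B) := by
        rw [MonObj.mul_one, MonObj.one_mul, tensorμ, braiding_tensorUnit_left]
        monoidal

lemma tensorMul_unitHead_unitTail : tensorMul (unitHead A B) (unitTail A B) = (β_ B A).hom := by
  calc tensorMul (unitHead A B) (unitTail A B)
      = ((λ_ B).inv ⊗ₘ (ρ_ A).inv) ≫ tensorμ (𝟙_ C) B A (𝟙_ C) ≫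
          (η[A] ▷ A ≫ μ[A] ⊗ₘ B ◁ η[B] ≫ μ[B]) := by
        simp only [tensorMul, MonObj.tensorObj.mul_def, unitTail, unitHead,
          ← tensorHom_comp_tensorHom, ← id_tensorHom, ← tensorHom_id, Category.assoc,
          tensorμ_natural_assoc]
    _ = (β_ B A).hom := by
        rw [MonObj.mul_one, MonObj.one_mul, tensorμ]
        monoidal

lemma tensorμ_comp_braiding (W X Y Z : C) :
    tensorμ W X Y Z ≫ (β_ W Y).hom ▷ (X ⊗ Z) ≫ (α_ Y W (X ⊗ Z)).hom =
      braidHead (W ⊗ X) Y Z ≫ Y ◁ (α_ W X Z).hom := by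
  rw [braidHead_tensor_left, tensorμ_eq_whiskerLeft_braidHead, Category.assoc, Category.assoc,
    ← braidHead]

variable {A B} {X Y : C}

lemma mul_comp_tensorMul_id (w : A ⟶ B) (hw : μ[A] ≫ w = (β_ A A).hom ≫ tensorMul w w) :
    μ[A ⊗ B] ≫ tensorMul w (𝟙 B) = (α_ (A ⊗ B) A B).inv ≫
      tensorMul ((β_ (A ⊗ B) A).hom ≫ tensorMul w (tensorMul w (𝟙 B))) (𝟙 B) := by
  have mul_eq : μ[B] = tensorMul (𝟙 B) (𝟙 B) := by simp [tensorMul]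
  calc μ[A ⊗ B] ≫ tensorMul w (𝟙 B) = tensorμ A B A B ≫ tensorMul (μ[A] ≫ w) μ[B] := by
        simp only [MonObj.tensorObj.mul_def, tensorMul, Category.assoc,
          tensorHom_comp_tensorHom_assoc, Category.comp_id]
    _ = (tensorμ A B A B ≫ (β_ A A).hom ▷ (B ⊗ B) ≫ (α_ A A (B ⊗ B)).hom) ≫
          tensorMul w (tensorMul w (tensorMul (𝟙 B) (𝟙 B))) := by
        simp only [hw, mul_eq, ← whiskerRight_comp_tensorMul, tensorMul_tensorMul, Category.assoc]
    _ = _ := by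
        rw [tensorμ_comp_braiding, braidHead, ← whiskerRight_comp_tensorMul, tensorMul_tensorMul,
          tensorMul_tensorMul, ← whiskerLeft_comp_tensorMul]
        simp only [Category.assoc]

-- Up to braidings, `w (a₁ a₂) b₁ b₂ = w a₂ (w a₁ b₁) b₂`, and `hf` trivializes `w a₁ b₁`.
lemma tensorMul_comp_tensorMul_id (w : A ⟶ B) (hw : μ[A] ≫ w = (β_ A A).hom ≫ tensorMul w w)
    (f : X ⟶ A ⊗ B) (e : X ⟶ 𝟙_ C) (hf : f ≫ tensorMul w (𝟙 B) = e ≫ η[B]) (g : Y ⟶ A ⊗ B) :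
    tensorMul f g ≫ tensorMul w (𝟙 B) = e ▷ Y ≫ (λ_ Y).hom ≫ g ≫ tensorMul w (𝟙 B) := by
  have cancel : f ▷ A ≫ (β_ (A ⊗ B) A).hom ≫ tensorMul w (tensorMul w (𝟙 B)) =
      e ▷ A ≫ (λ_ A).hom ≫ w := by
    rw [BraidedCategory.braiding_naturality_left_assoc, whiskerLeft_comp_tensorMul, hf,
      tensorMul_unit_right, ← BraidedCategory.braiding_naturality_left_assoc,
      braiding_rightUnitor_assoc]
  calc tensorMul f g ≫ tensorMul w (𝟙 B)
      = (X ◁ g ≫ f ▷ (A ⊗ B)) ≫ (α_ (A ⊗ B) A B).inv ≫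
          tensorMul ((β_ (A ⊗ B) A).hom ≫ tensorMul w (tensorMul w (𝟙 B))) (𝟙 B) := by
        rw [tensorMul, MonoidalCategory.tensorHom_def', Category.assoc, mul_comp_tensorMul_id w hw]
    _ = X ◁ g ≫ (α_ X A B).inv ≫ tensorMul (e ▷ A ≫ (λ_ A).hom ≫ w) (𝟙 B) := by
        rw [← cancel, ← whiskerRight_comp_tensorMul (f ▷ A)]
        monoidal
    _ = (X ◁ g ≫ e ▷ (A ⊗ B)) ≫ (λ_ (A ⊗ B)).hom ≫ tensorMul w (𝟙 B) := by
        rw [← whiskerRight_comp_tensorMul, ← whiskerRight_comp_tensorMul]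
        monoidal
    _ = e ▷ Y ≫ (λ_ Y).hom ≫ g ≫ tensorMul w (𝟙 B) := by
        rw [whisker_exchange, Category.assoc, leftUnitor_naturality_assoc]

end TensorMon

section ComulPow

variable {C : Type u} [Category.{v} C] [MonoidalCategory C] (H : C)

/-- The iterated comultiplication `H ⟶ H^{⊗n}`, extended by the counit to `n = 0`. -/
def comulPow [ComonObj H] : (n : ℕ) → (H ⟶ tensorPow H n)
  | 0 => ε[H]
  | n + 1 => Δ[H] ≫ H ◁ comulPow n

lemma iterComul_eq_comulPow [ComonObj H] (n : ℕ) : iterComul H n = comulPow H (n + 1) := by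
  induction n with
  | zero => exact (ComonObj.comul_counit H).symm
  | succ n ih => rw [iterComul, ih]; rfl

lemma comul_comp_whiskerLeft_comp_comulHead [ComonObj H] {X : C} (f : H ⟶ X) :
    (Δ[H] ≫ H ◁ f) ≫ comulHead H X = Δ[H] ≫ H ◁ (Δ[H] ≫ H ◁ f) := by
  rw [Category.assoc, whiskerLeft_comp_comulHead, comulHead, Category.assoc,
    whiskerLeft_comp, ComonObj.comul_assoc_assoc]

lemma comul_comp_whiskerLeft_comp_counitHead [ComonObj H] {X : C} (f : H ⟶ X) :
    (Δ[H] ≫ H ◁ f) ≫ counitHead H X = f := by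
  rw [Category.assoc, whiskerLeft_comp_counitHead, counitHead, Category.assoc,
    ComonObj.counit_comul_assoc, Iso.inv_hom_id_assoc]

lemma comulPow_comp_comulAt [ComonObj H] (n : ℕ) (i : Fin n) :
    comulPow H n ≫ comulAt H n i = comulPow H (n + 1) := by
  induction n with
  | zero => exact i.elim0
  | succ n ih =>
    cases i using Fin.cases with
    | zero => exact comul_comp_whiskerLeft_comp_comulHead H _
    | succ i =>
      rw [comulAt_succ, comulPow, Category.assoc, ← whiskerLeft_comp, ih, ← comulPow]

lemma comulPow_comp_counitAt [ComonObj H] (n : ℕ) (i : Fin (n + 1)) :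
    comulPow H (n + 1) ≫ counitAt H n i = comulPow H n := by
  induction n with
  | zero =>
    obtain rfl := Fin.fin_one_eq_zero i
    exact comul_comp_whiskerLeft_comp_counitHead H _
  | succ n ih =>
    cases i using Fin.cases with
    | zero => exact comul_comp_whiskerLeft_comp_counitHead H _
    | succ i =>
      rw [counitAt_succ, comulPow, Category.assoc, ← whiskerLeft_comp, ih, ← comulPow]

variable [BraidedCategory C]

/-- The monoid structure of the braided tensor power `H^{⊗n}`, whose product is `mulPow H n`. -/
instance monObjTensorPow (H : C) [MonObj H] : (n : ℕ) → MonObj (tensorPow H n)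
  | 0 => inferInstanceAs (MonObj (𝟙_ C))
  | n + 1 =>
    letI := monObjTensorPow H n
    inferInstanceAs (MonObj (H ⊗ tensorPow H n))

lemma mulPow_eq_mul [MonObj H] (n : ℕ) : mulPow H n = μ[tensorPow H n] := by
  induction n with
  | zero => exact mulPow_zero H
  | succ n ih => rw [mulPow_succ, ih]; rfl

instance isMonHom_comul [BimonObj H] : IsMonHom Δ[H] where

instance isMonHom_counit [BimonObj H] : IsMonHom ε[H] where

instance isMonHom_comulPow [BimonObj H] (n : ℕ) : IsMonHom (comulPow H n) := by
  induction n with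
  | zero => exact isMonHom_counit H
  | succ n ih => exact inferInstanceAs (IsMonHom (Δ[H] ≫ H ◁ comulPow H n))

instance isMonHom_comulAt [BimonObj H] (n : ℕ) (i : Fin n) : IsMonHom (comulAt H n i) := by
  induction n with
  | zero => exact i.elim0
  | succ n ih =>
    cases i using Fin.cases with
    | zero => exact inferInstanceAs (IsMonHom (Δ[H] ▷ tensorPow H n ≫ (α_ _ _ _).hom))
    | succ i => exact inferInstanceAs (IsMonHom (H ◁ comulAt H n i))

instance isMonHom_counitAt [BimonObj H] (n : ℕ) (i : Fin (n + 1)) : IsMonHom (counitAt H n i) := by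
  induction n with
  | zero => exact inferInstanceAs (IsMonHom (ε[H] ▷ tensorPow H 0 ≫ (λ_ _).hom))
  | succ n ih =>
    cases i using Fin.cases with
    | zero => exact inferInstanceAs (IsMonHom (ε[H] ▷ tensorPow H (n + 1) ≫ (λ_ _).hom))
    | succ i => exact inferInstanceAs (IsMonHom (H ◁ counitAt H n i))

end ComulPow

section TwistedAntipode

variable {C : Type u} [Category.{v} C] [MonoidalCategory C]

/-- The translation `(δ ⊗ 1) Δ` of a comonoid by a form `δ`; the twisted antipode is the antipode
preceded by it. -/
def translate (H : C) [ComonObj H] (δ : H ⟶ 𝟙_ C) : H ⟶ H :=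
  Δ[H] ≫ δ ▷ H ≫ (λ_ H).hom

lemma translate_comp_comul (H : C) [ComonObj H] (δ : H ⟶ 𝟙_ C) :
    translate H δ ≫ Δ[H] = Δ[H] ≫ translate H δ ▷ H := by
  calc translate H δ ≫ Δ[H] = Δ[H] ≫ (δ ▷ H ≫ 𝟙_ C ◁ Δ[H]) ≫ (λ_ (H ⊗ H)).hom := by
        unfold translate; monoidal
    _ = (Δ[H] ≫ H ◁ Δ[H]) ≫ δ ▷ (H ⊗ H) ≫ (λ_ (H ⊗ H)).hom := by
        rw [← whisker_exchange]; monoidal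
    _ = Δ[H] ≫ translate H δ ▷ H := by
        rw [ComonObj.comul_assoc]; unfold translate; monoidal

lemma translate_comp_counit (H : C) [ComonObj H] (δ : H ⟶ 𝟙_ C) : translate H δ ≫ ε[H] = δ := by
  calc translate H δ ≫ ε[H] = Δ[H] ≫ (δ ▷ H ≫ 𝟙_ C ◁ ε[H]) ≫ (λ_ (𝟙_ C)).hom := by
        unfold translate; monoidal
    _ = (Δ[H] ≫ H ◁ ε[H]) ≫ δ ▷ (𝟙_ C) ≫ (λ_ (𝟙_ C)).hom := by
        rw [← whisker_exchange]; monoidal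
    _ = δ := by rw [ComonObj.comul_counit]; monoidal

variable [BraidedCategory C] (H : C) [HopfObj H] (δ : H ⟶ 𝟙_ C)

lemma twistedAntipode_eq_translate_comp_antipode :
    twistedAntipode H δ = translate H δ ≫ 𝒮[H] := by
  simp [twistedAntipode, translate, MonoidalCategory.tensorHom_def]

lemma twistedAntipode_comp_comul :
    twistedAntipode H δ ≫ Δ[H] = Δ[H] ≫ (β_ H H).hom ≫ (𝒮[H] ⊗ₘ twistedAntipode H δ) := by
  rw [twistedAntipode_eq_translate_comp_antipode, Category.assoc, HopfObj.antipode_comul,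
    ← Category.assoc, translate_comp_comul, Category.assoc,
    BraidedCategory.braiding_naturality_left_assoc, whiskerLeft_comp_tensorHom]

lemma twistedAntipode_comp_counit : twistedAntipode H δ ≫ ε[H] = δ := by
  rw [twistedAntipode_eq_translate_comp_antipode, Category.assoc, HopfObj.antipode_counit,
    translate_comp_counit]

lemma comul_comp_tensorMul_antipode {A : C} [MonObj A] (f : H ⟶ A) [IsMonHom f] :
    Δ[H] ≫ tensorMul (𝒮[H] ≫ f) f = ε[H] ≫ η[A] := by
  calc Δ[H] ≫ tensorMul (𝒮[H] ≫ f) f = (Δ[H] ≫ 𝒮[H] ▷ H ≫ μ[H]) ≫ f := by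
        rw [Category.assoc, Category.assoc, IsMonHom.mul_hom, whiskerRight_comp_tensorHom_assoc,
          tensorMul]
    _ = ε[H] ≫ η[A] := by rw [HopfObj.antipode_left, Category.assoc, IsMonHom.one_hom]

lemma comul_comp_tensorMul_twistedAntipode {A : C} [MonObj A] (f : H ⟶ A) [IsMonHom f] :
    Δ[H] ≫ tensorMul (twistedAntipode H δ ≫ f) f = δ ≫ η[A] := by
  rw [twistedAntipode_eq_translate_comp_antipode, Category.assoc, ← whiskerRight_comp_tensorMul,
    ← Category.assoc, ← translate_comp_comul, Category.assoc, comul_comp_tensorMul_antipode,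
    ← Category.assoc, translate_comp_counit]

lemma twistedAntipode_comp_comul_comp_whiskerLeft {A : C} [MonObj A] (f : H ⟶ A) :
    twistedAntipode H δ ≫ Δ[H] ≫ H ◁ f =
      Δ[H] ≫ tensorMul (twistedAntipode H δ ≫ f ≫ unitHead H A) (𝒮[H] ≫ unitTail H A) := by
  rw [tensorMul, ← Category.assoc (twistedAntipode H δ) f, ← tensorHom_comp_tensorHom,
    Category.assoc, ← tensorMul, tensorMul_unitHead_unitTail, ← Category.assoc,
    twistedAntipode_comp_comul, Category.assoc, Category.assoc, tensorHom_comp_whiskerLeft,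
    BraidedCategory.braiding_naturality]

variable {H} {δ}

lemma IsCharacter.isMonHom (hδ : IsCharacter H δ) : IsMonHom δ where
  one_hom := hδ.one
  mul_hom := hδ.mul

lemma IsCharacter.isMonHom_translate (hδ : IsCharacter H δ) : IsMonHom (translate H δ) := by
  have := hδ.isMonHom
  unfold translate
  infer_instance

lemma IsCharacter.one_comp_twistedAntipode (hδ : IsCharacter H δ) :
    η[H] ≫ twistedAntipode H δ = η[H] := by
  have := hδ.isMonHom_translate
  rw [twistedAntipode_eq_translate_comp_antipode, IsMonHom.one_hom_assoc, HopfObj.one_antipode]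

lemma IsCharacter.mul_comp_twistedAntipode_comp (hδ : IsCharacter H δ) {A : C} [MonObj A]
    (f : H ⟶ A) [IsMonHom f] : μ[H] ≫ twistedAntipode H δ ≫ f =
      (β_ H H).hom ≫ tensorMul (twistedAntipode H δ ≫ f) (twistedAntipode H δ ≫ f) := by
  have := hδ.isMonHom_translate
  rw [← tensorMul_comp, tensorMul, twistedAntipode_eq_translate_comp_antipode, Category.assoc,
    IsMonHom.mul_hom_assoc, reassoc_of% HopfObj.mul_antipode H, tensorHom_comp_tensorHom_assoc,
    BraidedCategory.braiding_naturality_assoc, Category.assoc]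

lemma IsCharacter.twistedAntipode_comp (hδ : IsCharacter H δ) :
    twistedAntipode H δ ≫ δ = ε[H] := by
  have := hδ.isMonHom
  calc twistedAntipode H δ ≫ δ = Δ[H] ≫ H ◁ 𝒮[H] ≫ μ[H] ≫ δ := by
        rw [hδ.mul, twistedAntipode, MonoidalCategory.tensorHom_def' δ 𝒮[H],
          MonoidalCategory.tensorHom_def δ δ]
        monoidal
    _ = ε[H] := by rw [HopfObj.antipode_right_assoc, hδ.one, Category.comp_id]

end TwistedAntipode

section CyclicOp

variable {C : Type u} [Category.{v} C] [MonoidalCategory C] [BraidedCategory C] {H : C} [HopfObj H]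

lemma cyclicOp_succ (δ : H ⟶ 𝟙_ C) (σ : 𝟙_ C ⟶ H) (n : ℕ) :
    cyclicOp H δ σ (n + 1) =
      tensorMul (twistedAntipode H δ ≫ comulPow H (n + 1)) (appendLast H σ n) := by
  rw [cyclicOp, iterComul_eq_comulPow, mulPow_eq_mul, tensorMul]

variable {δ : H ⟶ 𝟙_ C} {σ : 𝟙_ C ⟶ H}

lemma IsCharacter.coface_zero_comp_cyclicOp (hδ : IsCharacter H δ) (n : ℕ) :
    coface H σ n 0 ≫ cyclicOp H δ σ (n + 1) = coface H σ n (Fin.last (n + 1)) := by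
  rw [coface_zero, coface_last, cyclicOp_succ, unitHead_comp_tensorMul]
  rw [← Category.assoc, hδ.one_comp_twistedAntipode, IsMonHom.one_hom]

lemma comulHead_comp_tensorMul_twistedAntipode {A X : C} [MonObj A] (f : H ⟶ A) (g : X ⟶ A) :
    comulHead H X ≫ tensorMul (twistedAntipode H δ ≫ Δ[H] ≫ H ◁ f) (H ◁ g) =
      tensorMul (twistedAntipode H δ ≫ f) g ≫ unitHead H A := by
  have whiskerLeft_eq : H ◁ g = tensorMul (unitTail H A) (g ≫ unitHead H A) := by
    rw [← whiskerLeft_comp_tensorMul, tensorMul_unitTail_unitHead, Category.comp_id]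
  calc comulHead H X ≫ tensorMul (twistedAntipode H δ ≫ Δ[H] ≫ H ◁ f) (H ◁ g) =
        comulHead H X ≫ comulHead H (H ⊗ X) ≫
          tensorMul (twistedAntipode H δ ≫ f ≫ unitHead H A)
            (tensorMul (𝒮[H] ≫ unitTail H A)
              (tensorMul (unitTail H A) (g ≫ unitHead H A))) := by
        rw [comulHead_comp_tensorMul, ← twistedAntipode_comp_comul_comp_whiskerLeft,
          whiskerLeft_eq]
    _ = comulHead H X ≫
          tensorMul (twistedAntipode H δ ≫ f ≫ unitHead H A)
            (tensorMul (ε[H] ≫ η[H ⊗ A]) (g ≫ unitHead H A)) := by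
        rw [← Category.assoc, ← comulHead_comp_whiskerLeft_comulHead, Category.assoc,
          whiskerLeft_comp_tensorMul, comulHead_comp_tensorMul, comul_comp_tensorMul_antipode]
    _ = (comulHead H X ≫ H ◁ counitHead H X) ≫
          tensorMul ((twistedAntipode H δ ≫ f) ≫ unitHead H A) (g ≫ unitHead H A) := by
        rw [tensorMul_unit_left, Category.assoc, whiskerLeft_comp_tensorMul, counitHead]
        simp only [Category.assoc]
    _ = tensorMul (twistedAntipode H δ ≫ f) g ≫ unitHead H A := by
        rw [comulHead_comp_whiskerLeft_counitHead, Category.id_comp, tensorMul_comp]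

lemma IsCocharacter.coface_one_comp_cyclicOp_one (hσ : IsCocharacter H σ) (hσδ : σ ≫ δ = 𝟙 (𝟙_ C)) :
    coface H σ 0 1 ≫ cyclicOp H δ σ 1 = coface H σ 0 0 := by
  have one_mul : σ ≫ (ρ_ H).inv = (λ_ (𝟙_ C)).inv ≫ (σ ⊗ₘ 𝟙 _) := by
    rw [tensorHom_id]; monoidal
  have appendLast_eq : appendLast H σ 0 = σ ≫ comulPow H 1 := by
    rw [← iterComul_eq_comulPow]; rfl
  calc coface H σ 0 1 ≫ cyclicOp H δ σ 1
      = (σ ≫ Δ[H]) ≫ tensorMul (twistedAntipode H δ ≫ comulPow H 1) (comulPow H 1) := by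
        rw [coface_one_zero, cyclicOp_succ, hσ.comul, one_mul, appendLast_eq, tensorMul, tensorMul]
        simp only [Category.assoc, tensorHom_comp_tensorHom_assoc, Category.id_comp]
    _ = coface H σ 0 0 := by
        rw [Category.assoc, comul_comp_tensorMul_twistedAntipode, reassoc_of% hσδ, coface_zero,
          unitHead, ← tensorHom_id]
        rfl

lemma IsCocharacter.coface_succ_comp_cyclicOp (hσ : IsCocharacter H σ) (hσδ : σ ≫ δ = 𝟙 (𝟙_ C))
    (n : ℕ) (i : Fin (n + 1)) :
    coface H σ n i.succ ≫ cyclicOp H δ σ (n + 1) =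
      cyclicOp H δ σ n ≫ coface H σ n i.castSucc := by
  cases n with
  | zero =>
    obtain rfl := Fin.fin_one_eq_zero i
    exact (hσ.coface_one_comp_cyclicOp_one hσδ).trans (Category.id_comp _).symm
  | succ n =>
    cases i using Fin.cases with
    | zero =>
      rw [Fin.succ_zero_eq_one, coface_one, Fin.castSucc_zero, coface_zero, cyclicOp_succ,
        cyclicOp_succ]
      exact comulHead_comp_tensorMul_twistedAntipode _ _
    | succ k =>
      have coface_appendLast : coface H σ n k.succ ≫ appendLast H σ (n + 1) =
          appendLast H σ n ≫ comulAt H (n + 1) k := by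
        rw [← coface_last, ← coface_last, ← coface_castSucc_succ H σ, ← Fin.succ_last (n + 1),
          hσ.coface_comp_coface_succ n k.succ (Fin.last (n + 1)) (Fin.le_last _),
          Fin.succ_castSucc]
      rw [coface_succ_succ, ← Fin.succ_castSucc, coface_castSucc_succ, cyclicOp_succ,
        cyclicOp_succ, whiskerLeft_comp_tensorMul, coface_appendLast, tensorMul_comp,
        Category.assoc, comulPow_comp_comulAt]

lemma counitAt_succ_comp_cyclicOp (n : ℕ) (i : Fin n) :
    counitAt H n i.succ ≫ cyclicOp H δ σ n =
      cyclicOp H δ σ (n + 1) ≫ counitAt H n i.castSucc := by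
  cases n with
  | zero => exact i.elim0
  | succ n =>
    have counitAt_appendLast : counitAt H n i ≫ appendLast H σ n =
        appendLast H σ (n + 1) ≫ counitAt H (n + 1) i.castSucc := by
      rw [← coface_last, ← coface_last, ← Fin.succ_last (n + 1),
        coface_succ_comp_counitAt_castSucc H σ n (Fin.last (n + 1)) i (Fin.castSucc_lt_last i)]
    rw [counitAt_succ, cyclicOp_succ, cyclicOp_succ, whiskerLeft_comp_tensorMul,
      counitAt_appendLast, tensorMul_comp, Category.assoc, comulPow_comp_counitAt]

lemma IsCocharacter.cyclicOp_comp_counitAt_last (hσ : IsCocharacter H σ) (n : ℕ) :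
    cyclicOp H δ σ (n + 1) ≫ counitAt H n (Fin.last n) =
      tensorMul (twistedAntipode H δ ≫ comulPow H n) (𝟙 (tensorPow H n)) := by
  rw [cyclicOp_succ, tensorMul_comp, Category.assoc, comulPow_comp_counitAt, ← coface_last,
    ← Fin.succ_last, hσ.coface_succ_comp_counitAt]

lemma appendLast_comp_tensorMul (hσδ : σ ≫ δ = 𝟙 (𝟙_ C)) (n : ℕ) :
    appendLast H σ n ≫ tensorMul (twistedAntipode H δ ≫ comulPow H n) (𝟙 (tensorPow H n)) =
      cyclicOp H δ σ n := by
  cases n with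
  | zero =>
    calc (σ ≫ (ρ_ H).inv) ≫ tensorMul (twistedAntipode H δ ≫ ε[H]) (𝟙 (𝟙_ C)) = σ ≫ δ := by
          rw [twistedAntipode_comp_counit]
          change (σ ≫ (ρ_ H).inv) ≫ (δ ⊗ₘ 𝟙 (𝟙_ C)) ≫ (λ_ (𝟙_ C)).hom = σ ≫ δ
          rw [tensorHom_id]
          monoidal
      _ = _ := hσδ
  | succ n => rw [cyclicOp_succ, appendLast, whiskerLeft_comp_tensorMul, Category.comp_id]

lemma IsCharacter.twistedAntipode_comp_comulPow_comp_tensorMul (hδ : IsCharacter H δ) (n : ℕ) :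
    (twistedAntipode H δ ≫ comulPow H (n + 1)) ≫
        tensorMul (twistedAntipode H δ ≫ comulPow H n) (𝟙 (tensorPow H n)) =
      ε[H] ≫ η[tensorPow H n] := by
  rw [comulPow, Category.assoc, Category.assoc, whiskerLeft_comp_tensorMul, Category.comp_id,
    comul_comp_tensorMul_twistedAntipode, ← Category.assoc, hδ.twistedAntipode_comp]

lemma IsCharacter.counitAt_zero_comp_cyclicOp (hδ : IsCharacter H δ) (hσ : IsCocharacter H σ)
    (hσδ : σ ≫ δ = 𝟙 (𝟙_ C)) (n : ℕ) :
    counitAt H n 0 ≫ cyclicOp H δ σ n =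
      cyclicOp H δ σ (n + 1) ≫ cyclicOp H δ σ (n + 1) ≫ counitAt H n (Fin.last n) := by
  rw [hσ.cyclicOp_comp_counitAt_last, cyclicOp_succ δ σ n, tensorMul_comp_tensorMul_id _
    (hδ.mul_comp_twistedAntipode_comp _) _ _ (hδ.twistedAntipode_comp_comulPow_comp_tensorMul n),
    appendLast_comp_tensorMul hσδ, counitAt_zero, counitHead, Category.assoc]

end CyclicOp

end BraidedHopf

theorem mainTheorem2_general {C : Type u} [Category.{v} C] [MonoidalCategory C] [BraidedCategory C]
    (H : C) [HopfObj H] (δ : H ⟶ 𝟙_ C) (σ : 𝟙_ C ⟶ H) (hδ : BraidedHopf.IsCharacter H δ)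
    (hσ : BraidedHopf.IsCocharacter H σ) (hσδ : σ ≫ δ = 𝟙 (𝟙_ C)) :
    IsParaCocyclic (BraidedHopf.tensorPow H) (BraidedHopf.coface H σ)
      (BraidedHopf.codegeneracy H) (BraidedHopf.cyclicOp H δ σ) where
  d_comp_d := hσ.coface_comp_coface_succ
  d_comp_s_of_le := BraidedHopf.coface_castSucc_comp_counitAt_succ H σ
  d_comp_s_self := BraidedHopf.coface_castSucc_comp_counitAt H σ
  d_comp_s_succ := hσ.coface_succ_comp_counitAt
  d_comp_s_of_gt := BraidedHopf.coface_succ_comp_counitAt_castSucc H σ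
  s_comp_s := BraidedHopf.counitAt_comp_counitAt H
  d_zero_comp_t := hδ.coface_zero_comp_cyclicOp
  d_succ_comp_t := hσ.coface_succ_comp_cyclicOp hσδ
  s_zero_comp_t := hδ.counitAt_zero_comp_cyclicOp hσ hσδ
  s_succ_comp_t := BraidedHopf.counitAt_succ_comp_cyclicOp

theorem mainTheorem2 {C : Type u} [Category.{v} C] [MonoidalCategory C] [BraidedCategory C]
    (H : C) [HopfObj H] (δ : H ⟶ 𝟙_ C) (σ : 𝟙_ C ⟶ H)
    (hδσ : BraidedHopf.IsModularPairInInvolution H δ σ) :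
    IsParaCocyclic (BraidedHopf.tensorPow H) (BraidedHopf.coface H σ)
      (BraidedHopf.codegeneracy H) (BraidedHopf.cyclicOp H δ σ) :=
  mainTheorem2_general H δ σ hδσ.character hδσ.cocharacter hδσ.modular
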